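/- Let $\omega=e^{i\pi/4}$ and let $H=\frac1{\sqrt2}\begin{pmatrix}1&1\\1&-1\end{pmatrix}$, $S=\mathrm{diag}(1,i)$, $T=\mathrm{diag}(1,\omega)$, $X=\begin{pmatrix}0&1\\1&0\end{pmatrix}$ in $U(2)$. Let $\mathcal S\subseteq U(2)$ be the subgroup generated by $S$, $X$ and the scalar $\omega$. A Matsumoto–Amano normal form is a word $M$ of the form $$(T\mid\varepsilon)\,(HT\mid SHT)^*\,(\varepsilon\mid H\mid SH)\,C,$$ where $\varepsilon$ is the empty word and $C\in\mathcal S$ is a single letter; its $T$-count and $H$-count are the numbers of letters $T$ and $H$ in $M$ (the letter $C$ contributes to neither), and its operator is the matrix product of its letters. Let $\mathbb Z[\omega]=\{a\omega^3+b\omega^2+c\omega+d\mid a,b,c,d\in\mathbb Z\}$. A natural number $k\ge 0$ is a denominator exponent of a $2\times 2$ complex matrix $U$ if all entries of $\sqrt2^{\,k}U$ lie in $\mathbb Z[\omega]$; in that case the $k$-residue $\rho_k(U)$ of $U$ is the matrix over $\mathbb Z[\omega]/(2)$ obtained by reducing the entries of $\sqrt2^{\,k}U$ modulo $2$. Let $M$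 be a Matsumoto–Amano normal form with operator $U\in U(2)$, $T$-count $t$ and $H$-count $h$, and let $k$ be the least denominator exponent of $U$. Then $$2k-3\le t\le 2k+1\qquad\text{and}\qquad 2k-2\le h\le 2k.$$ Moreover, the differences $2k-t$ and $2k-h$ depend only on the $k$-residue of $U$: if $M'$ is another Matsumoto–Amano normal form, with operator $U'$, counts $t',h'$ and least denominator exponent $k'$, and $\rho_k(U)=\rho_{k'}(U')$, then $2k-t=2k'-t'$ and $2k-h=2k'-h'$. -/

import Mathlib

open scoped Matrix

namespace CliffordT

noncomputable section

/-! ### The ring of cyclotomic integers of degree 8 -/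

/-- The eighth root of unity `ω = exp(iπ/4)`. -/
def omega : ℂ := Complex.exp (Real.pi * Complex.I / 4)

theorem omega_pow_four : omega ^ 4 = -1 := by
  rw [omega, ← Complex.exp_nat_mul, ← Complex.exp_pi_mul_I]
  congr 1
  push_cast
  ring

theorem omega_mul_conj : omega * star omega = 1 := by
  have h : star omega = Complex.exp (-(Real.pi * Complex.I / 4)) := by
    rw [omega, Complex.star_def, ← Complex.exp_conj]
    congr 1
    simp [Complex.conj_ofNat]
    ring
  rw [h, omega, ← Complex.exp_add]
  simp

theorem conj_omega : star omega = -omega ^ 3 := by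
  have h1 := omega_pow_four
  have h2 := omega_mul_conj
  have h3 : star omega * (omega ^ 4) = omega ^ 3 := by
    linear_combination omega ^ 3 * h2
  rw [h1] at h3
  linear_combination -h3

/-- `ℤ[ω] = {aω³ + bω² + cω + d | a, b, c, d ∈ ℤ}`, as a subring of `ℂ`. -/
def Zomega : Subring ℂ where
  carrier := {z | ∃ a b c d : ℤ, z = a * omega ^ 3 + b * omega ^ 2 + c * omega + d}
  mul_mem' := by
    rintro _ _ ⟨a, b, c, d, rfl⟩ ⟨a', b', c', d', rfl⟩
    refine ⟨a * d' + b * c' + c * b' + d * a', b * d' + c * c' + d * b' - a * a',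
      c * d' + d * c' - a * b' - b * a', d * d' - a * c' - b * b' - c * a', ?_⟩
    push_cast
    linear_combination (a * a' * omega ^ 2 + (a * b' + b * a') * omega
      + (a * c' + b * b' + c * a')) * omega_pow_four
  one_mem' := ⟨0, 0, 0, 1, by simp⟩
  add_mem' := by
    rintro _ _ ⟨a, b, c, d, rfl⟩ ⟨a', b', c', d', rfl⟩
    refine ⟨a + a', b + b', c + c', d + d', ?_⟩
    push_cast
    ring
  zero_mem' := ⟨0, 0, 0, 0, by simp⟩
  neg_mem' := by
    rintro _ ⟨a, b, c, d, rfl⟩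
    refine ⟨-a, -b, -c, -d, ?_⟩
    push_cast
    ring

/-- The ring of residues `ℤ[ω]/(2)`. -/
abbrev Residue : Type := Zomega ⧸ Ideal.span {(2 : Zomega)}

/-- The residue map `ρ : ℤ[ω] → ℤ[ω]/(2)`. -/
def rho : Zomega →+* Residue := Ideal.Quotient.mk (Ideal.span {(2 : Zomega)})

/-! ### Denominator exponents and `k`-residues -/

/-- The complex number `√2`. -/
def sqrtTwo : ℂ := (Real.sqrt 2 : ℝ)

theorem sqrtTwo_sq : sqrtTwo ^ 2 = 2 := by
  rw [sqrtTwo, ← Complex.ofReal_pow, Real.sq_sqrt (by norm_num)]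
  simp

/-- `k` is a denominator exponent of the matrix `U`: every entry of `√2ᵏ U` lies in `ℤ[ω]`. -/
def IsDenomExp (k : ℕ) (U : Matrix (Fin 2) (Fin 2) ℂ) : Prop :=
  ∀ i j, sqrtTwo ^ k * U i j ∈ Zomega

/-- `k` is the least denominator exponent of the matrix `U`. -/
def IsLeastDenomExp (k : ℕ) (U : Matrix (Fin 2) (Fin 2) ℂ) : Prop :=
  IsLeast {n : ℕ | IsDenomExp n U} k

/-- The `k`-residue `ρ_k(U) = ρ(√2ᵏ U)`, taken entry by entry, where `k` is a
(not necessarily least) denominator exponent of `U`. -/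
def kResidue (k : ℕ) (U : Matrix (Fin 2) (Fin 2) ℂ) (hk : IsDenomExp k U) :
    Matrix (Fin 2) (Fin 2) Residue :=
  Matrix.of fun i j => rho ⟨sqrtTwo ^ k * U i j, hk i j⟩

/-! ### The gates, as elements of `U(2)` -/

/-- The unitary group `U(2)`. -/
abbrev U2 : Type := Matrix.unitaryGroup (Fin 2) ℂ

/-- The Hadamard gate. -/
def gateH : U2 :=
  ⟨!![1 / sqrtTwo, 1 / sqrtTwo; 1 / sqrtTwo, -1 / sqrtTwo], by
    have h0 : sqrtTwo ≠ 0 := by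
      intro h
      have := sqrtTwo_sq
      simp [h] at this
    have h1 : star sqrtTwo = sqrtTwo := by simp [sqrtTwo]
    rw [Matrix.mem_unitaryGroup_iff, Matrix.star_eq_conjTranspose]
    ext i j
    fin_cases i <;> fin_cases j <;>
      simp [Matrix.mul_apply, Fin.sum_univ_two] <;>
      simp only [← Complex.star_def, h1] <;> field_simp <;> norm_num [sqrtTwo_sq]⟩

/-- A diagonal matrix `diag(u, v)` with `|u| = |v| = 1`. -/
def gateDiag (u v : ℂ) (hu : u * star u = 1) (hv : v * star v = 1) : U2 :=
  ⟨!![u, 0; 0, v], by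
    rw [Matrix.mem_unitaryGroup_iff, Matrix.star_eq_conjTranspose]
    simp only [Complex.star_def] at hu hv
    ext i j
    fin_cases i <;> fin_cases j <;>
      simp [Matrix.mul_apply, Fin.sum_univ_two, hu, hv]⟩

/-- The phase gate `S = diag(1, i)`. -/
def gateS : U2 := gateDiag 1 Complex.I (by simp) (by simp)

/-- The gate `T = diag(1, ω)`. -/
def gateT : U2 := gateDiag 1 omega (by simp) omega_mul_conj

/-- The scalar `ω`, as the matrix `ω I`. -/
def gateOmega : U2 := gateDiag omega omega omega_mul_conj omega_mul_conj

/-- The Pauli operator `X`. -/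
def gateX : U2 :=
  ⟨!![0, 1; 1, 0], by
    rw [Matrix.mem_unitaryGroup_iff, Matrix.star_eq_conjTranspose]
    ext i j
    fin_cases i <;> fin_cases j <;> simp [Matrix.mul_apply, Fin.sum_univ_two]⟩

/-- The subgroup of `U(2)` generated by `S`, `X` and the scalar `ω`. -/
def groupS : Subgroup U2 := Subgroup.closure {gateS, gateX, gateOmega}

/-! ### Normal forms -/

/-- The letters of circuits: `H`, `S`, `T`, and one letter for each operator in the subgroup
generated by `S`, `X`, `ω`. -/
inductive Gate : Type
  | H : Gate
  | S : Gate
  | T : Gate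
  | C (A : groupS) : Gate

/-- The operator denoted by a letter. -/
def Gate.op : Gate → U2
  | .H => gateH
  | .S => gateS
  | .T => gateT
  | .C A => (A : U2)

/-- The operator denoted by a circuit: the matrix product, in the order written. -/
def circuitOp (M : List Gate) : U2 := (M.map Gate.op).prod

/-- The number of letters `T` in a circuit. -/
def tCount : List Gate → ℕ
  | [] => 0
  | .T :: M => tCount M + 1
  | _ :: M => tCount M

/-- The number of letters `H` in a circuit. -/
def hCount : List Gate → ℕ
  | [] => 0
  | .H :: M => hCount M + 1
  | _ :: M => hCount M

/-- A set of words, regarded as a language. -/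
def words (s : Set (List Gate)) : Language Gate := s

open scoped Computability in
/-- The language of Matsumoto-Amano normal forms
`(T | ε) (HT | SHT)* (ε | H | SH) C`, where `C` is a single operator in `groupS`.
(For languages, `*` is concatenation and `∗` is Kleene star.) -/
def normalForms : Language Gate :=
  words {[Gate.T], []} *
    (words {[Gate.H, Gate.T], [Gate.S, Gate.H, Gate.T]})∗ *
    words {[], [Gate.H], [Gate.S, Gate.H]} *
    words {M | ∃ A : groupS, M = [Gate.C A]}

/-! ### Every circuit has a least denominator exponent -/

theorem omega_mem : omega ∈ Zomega := ⟨0, 0, 1, 0, by simp⟩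

theorem omega_eq : omega = (1 + Complex.I) / sqrtTwo := by
  have h0 : sqrtTwo ≠ 0 := by
    intro h
    have := sqrtTwo_sq
    simp [h] at this
  have h1 : omega = Real.cos (Real.pi / 4) + Real.sin (Real.pi / 4) * Complex.I := by
    rw [omega, Complex.ofReal_cos, Complex.ofReal_sin, ← Complex.exp_mul_I]
    congr 1
    push_cast
    ring
  have h2 : ((Real.sqrt 2 / 2 : ℝ) : ℂ) = sqrtTwo / 2 := by simp [sqrtTwo]
  rw [h1, Real.cos_pi_div_four, Real.sin_pi_div_four, h2]
  field_simp
  rw [sqrtTwo_sq]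

theorem I_mem : Complex.I ∈ Zomega := by
  have h0 : sqrtTwo ≠ 0 := by
    intro h
    have := sqrtTwo_sq
    simp [h] at this
  have : Complex.I = omega ^ 2 := by
    rw [omega_eq, div_pow, sqrtTwo_sq]
    linear_combination (-1 / 2 : ℂ) * Complex.I_sq
  rw [this]
  exact Zomega.pow_mem omega_mem 2

theorem conj_mem {z : ℂ} (hz : z ∈ Zomega) : star z ∈ Zomega := by
  obtain ⟨a, b, c, d, rfl⟩ := hz
  have h : star omega ∈ Zomega := by
    rw [conj_omega]
    exact Zomega.neg_mem (Zomega.pow_mem omega_mem 3)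
  simp only [star_add, star_mul', star_pow, star_intCast]
  exact Zomega.add_mem (Zomega.add_mem (Zomega.add_mem
    (Zomega.mul_mem (intCast_mem Zomega a) (Zomega.pow_mem h 3))
    (Zomega.mul_mem (intCast_mem Zomega b) (Zomega.pow_mem h 2)))
    (Zomega.mul_mem (intCast_mem Zomega c) h)) (intCast_mem Zomega d)

theorem IsDenomExp.mul {k l : ℕ} {U V : Matrix (Fin 2) (Fin 2) ℂ}
    (hU : IsDenomExp k U) (hV : IsDenomExp l V) : IsDenomExp (k + l) (U * V) := by
  intro i j
  have : sqrtTwo ^ (k + l) * (U * V) i j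
      = sqrtTwo ^ k * U i 0 * (sqrtTwo ^ l * V 0 j)
        + sqrtTwo ^ k * U i 1 * (sqrtTwo ^ l * V 1 j) := by
    simp only [Matrix.mul_apply, Fin.sum_univ_two]
    ring
  rw [this]
  exact Zomega.add_mem (Zomega.mul_mem (hU _ _) (hV _ _)) (Zomega.mul_mem (hU _ _) (hV _ _))

theorem isDenomExp_gateDiag {u v : ℂ} (hu : u * star u = 1) (hv : v * star v = 1)
    (hu' : u ∈ Zomega) (hv' : v ∈ Zomega) :
    IsDenomExp 0 (gateDiag u v hu hv : U2).1 := by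
  intro i j
  fin_cases i <;> fin_cases j <;> simp [gateDiag, hu', hv', Zomega.zero_mem]

theorem isDenomExp_groupS (A : U2) (hA : A ∈ groupS) : IsDenomExp 0 A.1 := by
  induction hA using Subgroup.closure_induction with
  | mem x hx =>
    rcases hx with rfl | rfl | rfl
    · exact isDenomExp_gateDiag _ _ Zomega.one_mem I_mem
    · intro i j
      fin_cases i <;> fin_cases j <;> simp [gateX, Zomega.zero_mem, Zomega.one_mem]
    · exact isDenomExp_gateDiag _ _ omega_mem omega_mem
  | one =>
    intro i j
    fin_cases i <;> fin_cases j <;> simp [Zomega.zero_mem, Zomega.one_mem]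
  | mul x y _ _ hx hy => exact hx.mul hy
  | inv x _ hx =>
    intro i j
    have := conj_mem (hx j i)
    simpa using this

theorem Gate.exists_isDenomExp (g : Gate) : ∃ k, IsDenomExp k g.op.1 := by
  have h0 : sqrtTwo ≠ 0 := by
    intro h
    have := sqrtTwo_sq
    simp [h] at this
  cases g with
  | H =>
    refine ⟨1, fun i j => ?_⟩
    fin_cases i <;> fin_cases j <;>
      simp [Gate.op, gateH, h0, neg_div, Zomega.one_mem, Zomega.neg_mem]
  | S => exact ⟨0, isDenomExp_gateDiag (by simp) (by simp) Zomega.one_mem I_mem⟩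
  | T => exact ⟨0, isDenomExp_gateDiag (by simp) omega_mul_conj Zomega.one_mem omega_mem⟩
  | C A => exact ⟨0, isDenomExp_groupS A.1 A.2⟩

/-- Every circuit operator has a least denominator exponent. -/
theorem exists_isLeastDenomExp (M : List Gate) :
    ∃ k, IsLeastDenomExp k (circuitOp M).1 := by
  have h : ∃ k, IsDenomExp k (circuitOp M).1 := by
    induction M with
    | nil =>
      refine ⟨0, ?_⟩
      exact isDenomExp_groupS 1 groupS.one_mem
    | cons g M ih =>
      obtain ⟨k, hk⟩ := g.exists_isDenomExp
      obtain ⟨l, hl⟩ := ih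
      exact ⟨k + l, hk.mul hl⟩
  classical
  exact ⟨Nat.find h, Nat.find_spec h, fun n hn => Nat.find_min' h hn⟩

end

end CliffordT

/-!
The proof is `δ`-adic, for the prime `δ = 1 + ω` of `ℤ[ω]`: up to units, `√2` is `δ²` and `2` is
`δ⁴`. A normal form with at least one `H` is a product `Tᵅ G Tᵝ C` with `α, β ≤ 1`, where `G` is an
alternating product `(H | SH) T (H | SH) T ⋯ T (H | SH)`. If `G` contains `n + 1` letters `H`, then
`h = n + 1` and `t = n + α + β`.

The operators `H` and `S` preserve the lattice of vectors `(x, y)` with `x ≡ y mod √2`. In a basis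
of this lattice, `H` exchanges the basis vectors, `S` is lower triangular, and `T` has denominator
exactly `δ`, the matrix `δ T` being of rank one modulo `δ`. By induction on `n` the matrix of `δⁿ G`
in this basis is integral, and its upper right entry `b` is prime to `δ`
(`IsCore.gateH_mul_gateT_mul`, `IsCore.gateS_mul`). In the standard basis this says that `√2 δⁿ G`
is integral, with all four entries congruent to `b` modulo `δ²` (`IsCore.hasShape`). The outer
factors `Tᵅ` and `Tᵝ` turn this into `b (1, ω^α)ᵀ (1, ω^β)`, and multiplication by `C` changes only
`b`, because `i ≡ 1` modulo `δ²` (`HasShape.mul_of_mem_groupS`).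

Hence the exact denominator of the operator is `δ^(n + 2)`, and `2k = n + 2 + ε` with `ε ≤ 1`
(`HasShape.exists_isReducedShape`). This gives all the inequalities, as well as `2k - h = 1 + ε` and
`2k - t = 2 + ε - α - β`. Since `ω ≢ 1` modulo `δ²`, the numbers `ε`, `α`, `β` can be read off from
the scaled matrix modulo `δ³`, and so from its residue modulo `2` (`IsReducedShape.congr`).

A normal form without `H` is `Tᵅ C`, with `k = h = 0` and `t = α`. Its determinant is `ω^α` times a
power of `i`, which determines `α` modulo `δ²`; being prime to `δ`, it also separates this case from
the previous one.
-/

namespace CliffordT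

/-! ### Divisibility by the prime `1 + ω` -/

/-- The element `ω` of the ring `ℤ[ω]`. -/
noncomputable def w : Zomega := ⟨omega, omega_mem⟩

/-- The prime `δ = 1 + ω` of `ℤ[ω]` above `2`; the element `√2` is a unit multiple of `δ²`. -/
noncomputable def delta : Zomega := 1 + w

/-- The unit `√2 / δ²` of `ℤ[ω]`, equal to `ω⁻¹ (√2 - 1)`. -/
noncomputable def unitV : Zomega := 1 - w ^ 2 + w ^ 3

theorem w_pow_four : w ^ 4 = -1 := by
  apply Subtype.ext
  simpa [w] using omega_pow_four

theorem coe_w : (w : ℂ) = omega := rfl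

theorem coe_delta : (delta : ℂ) = 1 + omega := rfl

theorem sqrtTwo_ne_zero : sqrtTwo ≠ 0 := by
  intro h
  have := sqrtTwo_sq
  simp [h] at this

theorem omega_sq : omega ^ 2 = Complex.I := by
  rw [omega_eq, div_pow, sqrtTwo_sq]
  linear_combination (1 / 2 : ℂ) * Complex.I_sq

theorem sqrtTwo_eq : sqrtTwo = omega - omega ^ 3 := by
  have h0 := sqrtTwo_ne_zero
  have h1 : omega * sqrtTwo = 1 + Complex.I := by
    rw [omega_eq]
    field_simp
  rw [← omega_sq] at h1
  linear_combination (-omega ^ 3) * h1 + (sqrtTwo - omega) * omega_pow_four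

theorem sqrtTwo_eq_delta_sq_mul : sqrtTwo = ((delta ^ 2 * unitV : Zomega) : ℂ) := by
  rw [sqrtTwo_eq]
  simp only [delta, unitV, w]
  push_cast
  linear_combination (-omega - 1) * omega_pow_four

theorem isUnit_w : IsUnit w :=
  IsUnit.of_mul_eq_one (-w ^ 3) (by linear_combination -w_pow_four)

/-- The inverse is `ω (1 + √2)`. -/
theorem isUnit_unitV : IsUnit unitV :=
  IsUnit.of_mul_eq_one (w + w ^ 2 - w ^ 4) (by
    simp only [unitV]
    linear_combination (-w ^ 3 + w ^ 2 + w - 1) * w_pow_four)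

theorem two_eq : (2 : Zomega) = delta ^ 4 * unitV ^ 2 := by
  apply Subtype.ext
  have h := sqrtTwo_eq_delta_sq_mul
  have h2 := sqrtTwo_sq
  rw [h] at h2
  push_cast at h2 ⊢
  change (2 : ℂ) = _
  linear_combination -h2

theorem delta_pow_four_dvd_two : delta ^ 4 ∣ 2 := ⟨_, two_eq⟩

/-- The element `δ` is not a unit: otherwise `1/2` would be an algebraic integer. -/
theorem not_isUnit_delta : ¬ IsUnit delta := by
  intro h
  have h2 : IsUnit (2 : Zomega) := by
    rw [two_eq]
    exact (h.pow 4).mul (isUnit_unitV.pow 2)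
  obtain ⟨y, hy⟩ := h2.exists_right_inv
  have hy' : (2 : ℂ) * (y : ℂ) = 1 := congrArg Subtype.val hy
  have hw : IsIntegral ℤ omega := by
    refine IsIntegral.of_pow (n := 4) (by norm_num) ?_
    rw [omega_pow_four]
    exact isIntegral_one.neg
  have hint : IsIntegral ℤ (y : ℂ) := by
    obtain ⟨a, b, c, d, h⟩ := y.2
    rw [h]
    have hz (n : ℤ) : IsIntegral ℤ (n : ℂ) := isIntegral_algebraMap (R := ℤ) (x := n)
    exact ((((hz a).mul (hw.pow 3)).add ((hz b).mul (hw.pow 2))).add ((hz c).mul hw)).add (hz d)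
  have hq : (y : ℂ) = algebraMap ℚ ℂ (1 / 2) := by
    simp
    linear_combination (1 / 2 : ℂ) * hy'
  rw [hq, isIntegral_algebraMap_iff (algebraMap ℚ ℂ).injective,
    IsIntegrallyClosed.isIntegral_iff] at hint
  obtain ⟨n, hn⟩ := hint
  have h3 : (2 * n : ℚ) = 1 := by
    simp at hn
    rw [hn]
    norm_num
  have h4 : 2 * n = 1 := by exact_mod_cast h3
  omega

theorem not_delta_dvd_of_isUnit {x : Zomega} (hx : IsUnit x) : ¬ delta ∣ x :=
  fun h => not_isUnit_delta (isUnit_of_dvd_unit h hx)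

theorem delta_ne_zero : delta ≠ 0 := by
  intro h
  have := two_eq
  rw [h] at this
  norm_num at this

/-- Here `ω² - 1 = δ (δ - 2)`, and `δ⁴` divides `2`. -/
theorem delta_sq_dvd_w_pow_two_mul_sub_one (l : ℕ) : delta ^ 2 ∣ w ^ (2 * l) - 1 := by
  have h : delta ^ 2 ∣ w ^ 2 - 1 := by
    refine ⟨1 - delta ^ 3 * unitV ^ 2, ?_⟩
    have h : w = delta - 1 := by simp [delta]
    rw [h]
    linear_combination -delta * two_eq
  rw [pow_mul]
  exact h.trans (sub_one_dvd_pow_sub_one _ _)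

/-- The element `ω - 1 = δ - 2` is exactly divisible by `δ`. -/
theorem not_delta_sq_dvd_mul_w_sub_one {x : Zomega} (hx : ¬ delta ∣ x) :
    ¬ delta ^ 2 ∣ x * (w - 1) := by
  rintro ⟨y, hy⟩
  apply hx
  refine ⟨y + delta ^ 2 * unitV ^ 2 * x, ?_⟩
  apply mul_left_cancel₀ delta_ne_zero
  have := two_eq
  have h : w = delta - 1 := by simp [delta]
  rw [h] at hy
  linear_combination hy + x * this

/-- Modulo `δ²`, the powers `ω⁰` and `ω¹` remain distinct, even after multiplication by an
element prime to `δ`. -/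
theorem eq_zero_iff_delta_sq_dvd {x : Zomega} (hx : ¬ delta ∣ x) {α : ℕ} (hα : α ≤ 1) :
    delta ^ 2 ∣ x * (w ^ α - 1) ↔ α = 0 := by
  interval_cases α
  · simp
  · simpa using not_delta_sq_dvd_mul_w_sub_one hx

/-! ### Circuits that begin and end with a Hadamard gate -/

/-- The inclusion of `ℤ[ω]` into `ℂ`, entry by entry on matrices. -/
abbrev toComplex : Matrix (Fin 2) (Fin 2) Zomega →+* Matrix (Fin 2) (Fin 2) ℂ :=
  Zomega.subtype.mapMatrix

/-- A basis, by columns, of the lattice `{(x, y) ∈ ℤ[ω]² | x ≡ y mod √2}`, which `H` and `S`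
preserve. -/
noncomputable def latticeBasis : Matrix (Fin 2) (Fin 2) ℂ := !![1, sqrtTwo; 1, 0]

/-- The matrix `√2 • latticeBasis⁻¹`. -/
noncomputable def latticeBasisInv : Matrix (Fin 2) (Fin 2) ℂ := !![0, sqrtTwo; 1, -1]

/-- In the basis `latticeBasis`, the matrix `δⁿ V` is integral, and its upper right entry
is prime to `δ`. -/
def IsCore (n : ℕ) (V : Matrix (Fin 2) (Fin 2) ℂ) : Prop :=
  ∃ W : Matrix (Fin 2) (Fin 2) Zomega, ¬ delta ∣ W 0 1 ∧
    (sqrtTwo * (delta : ℂ) ^ n) • V = latticeBasis * toComplex W * latticeBasisInv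

theorem isCore_gateH : IsCore 0 gateH.1 := by
  refine ⟨!![0, 1; 1, 0], ?_, ?_⟩
  · simpa using not_delta_dvd_of_isUnit isUnit_one
  · have h0 := sqrtTwo_ne_zero
    have h2 := sqrtTwo_sq
    ext i j
    fin_cases i <;> fin_cases j <;>
      simp [gateH, latticeBasis, latticeBasisInv, Matrix.mul_apply, Matrix.vecMul, dotProduct,
        Fin.sum_univ_two, h0]
    · linear_combination -h2
    · field_simp

/-- The operator `S`, in the basis `latticeBasis`. -/
theorem gateS_mul_latticeBasis :
    gateS.1 * latticeBasis = latticeBasis * toComplex !![w ^ 2, 0; -w ^ 3, 1] := by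
  have h4 := omega_pow_four
  have h := sqrtTwo_eq
  ext i j
  fin_cases i <;> fin_cases j <;>
    simp [gateS, gateDiag, latticeBasis, Matrix.mul_apply, Fin.sum_univ_two, coe_w, omega_sq]
  rw [h, ← omega_sq]
  linear_combination (1 - omega ^ 2) * h4

/-- The operator `δ HT`, in the basis `latticeBasis`. -/
theorem gateH_mul_gateT_mul_latticeBasis :
    (delta : ℂ) • (gateH.1 * gateT.1 * latticeBasis)
      = latticeBasis * toComplex !![-w ^ 3, delta; delta * w, 0] := by
  have h4 := omega_pow_four
  have h := sqrtTwo_eq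
  have h2 := sqrtTwo_sq
  have h0 := sqrtTwo_ne_zero
  ext i j
  fin_cases i <;> fin_cases j <;>
    simp [gateH, gateT, gateDiag, latticeBasis, Matrix.mul_apply, Fin.sum_univ_two, coe_w,
      coe_delta, h0] <;>
    field_simp <;> rw [h]
  · linear_combination (1 + 2 * omega + omega ^ 2 - omega ^ 3 - omega ^ 4) * h4
  · linear_combination (1 - omega ^ 2) * h4

theorem IsCore.gateS_mul {n : ℕ} {V : Matrix (Fin 2) (Fin 2) ℂ} (hV : IsCore n V) :
    IsCore n (gateS.1 * V) := by
  obtain ⟨W, hb, hW⟩ := hV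
  refine ⟨!![w ^ 2, 0; -w ^ 3, 1] * W, ?_, ?_⟩
  · simpa [Matrix.mul_apply, Matrix.vecMul, dotProduct, Fin.sum_univ_two,
      (isUnit_w.pow 2).dvd_mul_left] using hb
  · rw [← Matrix.mul_smul, hW, map_mul]
    simp only [← Matrix.mul_assoc, gateS_mul_latticeBasis]

/-- Modulo `δ`, the matrix of `δ HT` in the basis `latticeBasis` is `diag(ω⁻¹, 0)`, so that the
upper right entry is only multiplied by a unit. -/
theorem IsCore.gateH_mul_gateT_mul {n : ℕ} {V : Matrix (Fin 2) (Fin 2) ℂ} (hV : IsCore n V) :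
    IsCore (n + 1) (gateH.1 * gateT.1 * V) := by
  obtain ⟨W, hb, hW⟩ := hV
  refine ⟨!![-w ^ 3, delta; delta * w, 0] * W, ?_, ?_⟩
  · have : ¬ delta ∣ -w ^ 3 * W 0 1 := by
      rwa [(isUnit_w.pow 3).neg.dvd_mul_left]
    simpa [Matrix.mul_apply, Matrix.vecMul, dotProduct, Fin.sum_univ_two,
      dvd_add_left (dvd_mul_right delta _)] using this
  · rw [pow_succ', mul_left_comm, mul_smul, ← Matrix.mul_smul, hW, map_mul]
    simp only [← Matrix.mul_assoc, ← gateH_mul_gateT_mul_latticeBasis, Matrix.smul_mul]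

/-! ### Residues modulo `δ²` -/

/-- The matrix `√2 δⁿ V` is integral, and modulo `δ²` it is the rank one matrix
`x (1, ω^α)ᵀ (1, ω^β)`, for some `x` prime to `δ`. -/
def HasShape (n α β : ℕ) (V : Matrix (Fin 2) (Fin 2) ℂ) : Prop :=
  ∃ N : Matrix (Fin 2) (Fin 2) Zomega, (sqrtTwo * (delta : ℂ) ^ n) • V = toComplex N ∧
    ∃ x, ¬ delta ∣ x ∧ ∀ i j : Fin 2, delta ^ 2 ∣ N i j - x * w ^ (α * i + β * j : ℕ)

theorem gateT_pow (α : ℕ) : (gateT ^ α).1 = !![1, 0; 0, omega ^ α] := by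
  induction α with
  | zero => simp [Matrix.one_fin_two]
  | succ n ih =>
    rw [pow_succ]
    change (gateT ^ n).1 * gateT.1 = _
    rw [ih]
    ext i j
    fin_cases i <;> fin_cases j <;>
      simp [gateT, gateDiag, Matrix.mul_apply, Fin.sum_univ_two, pow_succ]

/-- Modulo `δ²`, where `√2` and `2` vanish, each of the four entries of
`latticeBasis * W * latticeBasisInv` is congruent to `W 0 1`. -/
theorem IsCore.hasShape {n : ℕ} {V : Matrix (Fin 2) (Fin 2) ℂ} (hV : IsCore n V) (α β : ℕ) :
    HasShape n α β ((gateT ^ α).1 * V * (gateT ^ β).1) := by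
  obtain ⟨W, hb, hW⟩ := hV
  refine ⟨!![1, 0; 0, w ^ α] * !![1, w - w ^ 3; 1, 0] * W * !![0, w - w ^ 3; 1, -1] *
    !![1, 0; 0, w ^ β], ?_, W 0 1, hb, ?_⟩
  · have h1 (γ : ℕ) : (gateT ^ γ).1 = toComplex !![1, 0; 0, w ^ γ] := by
      rw [gateT_pow]
      ext i j
      fin_cases i <;> fin_cases j <;> simp [coe_w]
    have h2 : latticeBasis = toComplex !![1, w - w ^ 3; 1, 0] := by
      ext i j
      fin_cases i <;> fin_cases j <;> simp [coe_w, latticeBasis, sqrtTwo_eq]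
    have h3 : latticeBasisInv = toComplex !![0, w - w ^ 3; 1, -1] := by
      ext i j
      fin_cases i <;> fin_cases j <;> simp [coe_w, latticeBasisInv, sqrtTwo_eq]
    rw [← Matrix.smul_mul, ← Matrix.mul_smul, hW, h1, h1, h2, h3]
    simp only [map_mul, Matrix.mul_assoc]
  · have hr : w - w ^ 3 = delta ^ 2 * unitV := by
      apply Subtype.ext
      rw [← sqrtTwo_eq_delta_sq_mul, sqrtTwo_eq]
      rfl
    rw [hr]
    intro i j
    fin_cases i <;> fin_cases j <;>
      simp [Matrix.mul_apply, Matrix.vecMul, dotProduct, Fin.sum_univ_two]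
    · exact ⟨unitV * W 1 1, by ring⟩
    · refine ⟨w ^ β * unitV * (W 0 0 + delta ^ 2 * unitV * W 1 0 - W 1 1
        - delta ^ 2 * unitV * W 0 1), ?_⟩
      linear_combination (-w ^ β * W 0 1) * two_eq
    · refine ⟨0, ?_⟩
      ring
    · refine ⟨w ^ (α + β) * unitV * (W 0 0 - delta ^ 2 * unitV * W 0 1), ?_⟩
      linear_combination (-w ^ (α + β) * W 0 1) * two_eq

/-! ### The group generated by `S`, `X` and `ω` -/

theorem isOfFinOrder_of_mem_generators {g : U2} (hg : g ∈ ({gateS, gateX, gateOmega} : Set U2)) :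
    IsOfFinOrder g := by
  have key (g : U2) (h : g.1 ^ 8 = 1) : IsOfFinOrder g :=
    isOfFinOrder_iff_pow_eq_one.2 ⟨8, by norm_num, Subtype.ext h⟩
  have hdiag (u v : ℂ) : !![u, 0; 0, v] = Matrix.diagonal ![u, v] := by
    ext i j
    fin_cases i <;> fin_cases j <;> simp
  have h8 : omega ^ 8 = 1 := by
    linear_combination (omega ^ 4 - 1) * omega_pow_four
  apply key
  rcases hg with rfl | rfl | rfl
  · simp only [gateS, gateDiag, hdiag, Matrix.diagonal_pow, ← Matrix.diagonal_one]
    congr 1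
    ext i
    fin_cases i <;> simp [← omega_sq, ← pow_mul]
    linear_combination (omega ^ 8 + 1) * h8
  · have : gateX.1 ^ 2 = 1 := by
      rw [pow_two]
      ext i j
      fin_cases i <;> fin_cases j <;> simp [gateX]
    rw [show 8 = 2 * 4 from rfl, pow_mul, this, one_pow]
  · simp only [gateOmega, gateDiag, hdiag, Matrix.diagonal_pow, ← Matrix.diagonal_one]
    congr 1
    ext i
    fin_cases i <;> simp [h8]

/-- The generators of `groupS` have finite order, so that they generate it as a monoid. -/
theorem groupS_induction {p : U2 → Prop} (one : p 1) (mul_S : ∀ A, p A → p (A * gateS))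
    (mul_X : ∀ A, p A → p (A * gateX)) (mul_omega : ∀ A, p A → p (A * gateOmega))
    {A : U2} (hA : A ∈ groupS) : p A := by
  rw [groupS, ← Subgroup.mem_toSubmonoid, Subgroup.closure_toSubmonoid_of_isOfFinOrder
    (fun _ => isOfFinOrder_of_mem_generators)] at hA
  induction hA using Submonoid.closure_induction_right with
  | one => exact one
  | mul_right x _ y hy ih =>
    rcases hy with rfl | rfl | rfl
    exacts [mul_S _ ih, mul_X _ ih, mul_omega _ ih]

theorem exists_det_eq_of_mem_groupS {A : U2} (hA : A ∈ groupS) :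
    ∃ l : ℕ, A.1.det = omega ^ (2 * l) := by
  refine groupS_induction (p := fun A => ∃ l : ℕ, A.1.det = omega ^ (2 * l)) ⟨0, by simp⟩
    ?_ ?_ ?_ hA <;> rintro A ⟨l, hl⟩
  · refine ⟨l + 1, ?_⟩
    change (A.1 * gateS.1).det = _
    rw [Matrix.det_mul, hl, mul_add, pow_add]
    simp [gateS, gateDiag, omega_sq]
  · refine ⟨l + 2, ?_⟩
    change (A.1 * gateX.1).det = _
    rw [Matrix.det_mul, hl, mul_add, pow_add]
    simp [gateX, omega_pow_four]
  · refine ⟨l + 1, ?_⟩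
    change (A.1 * gateOmega.1).det = _
    rw [Matrix.det_mul, hl, mul_add, pow_add]
    simp [gateOmega, gateDiag, pow_two]

/-- Modulo `δ²`, the operator `S` is the identity, and `X`, which exchanges the columns, multiplies
`(1, ω^β)` by `ω^β`, since `ω²` is congruent to `1`. -/
theorem HasShape.mul_of_mem_groupS {n α β : ℕ} {V : Matrix (Fin 2) (Fin 2) ℂ}
    (hV : HasShape n α β V) {A : U2} (hA : A ∈ groupS) : HasShape n α β (V * A.1) := by
  refine groupS_induction (p := fun A => HasShape n α β (V * A.1)) (by simpa using hV)
    ?_ ?_ ?_ hA <;> rintro A ⟨N, hN, x, hx, h⟩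
  · refine ⟨N * !![1, 0; 0, w ^ 2], ?_, x, hx, ?_⟩
    · change _ • (V * (A.1 * gateS.1)) = _
      have : gateS.1 = toComplex !![1, 0; 0, w ^ 2] := by
        ext i j
        fin_cases i <;> fin_cases j <;> simp [gateS, gateDiag, coe_w, omega_sq]
      rw [← Matrix.mul_assoc, ← Matrix.smul_mul, hN, this, map_mul]
    · intro i j
      fin_cases j
      · simpa [Matrix.mul_apply] using h i 0
      · have := dvd_add (h i 1) ((delta_sq_dvd_w_pow_two_mul_sub_one 1).mul_left (N i 1))
        convert this using 1
        simp [Matrix.mul_apply]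
        ring
  · refine ⟨N * !![0, 1; 1, 0], ?_, x * w ^ β, ?_, ?_⟩
    · change _ • (V * (A.1 * gateX.1)) = _
      have : gateX.1 = toComplex !![0, 1; 1, 0] := by
        ext i j
        fin_cases i <;> fin_cases j <;> simp [gateX]
      rw [← Matrix.mul_assoc, ← Matrix.smul_mul, hN, this, map_mul]
    · rwa [(isUnit_w.pow β).dvd_mul_right]
    · intro i j
      fin_cases j
      · convert h i 1 using 1
        simp [Matrix.mul_apply]
        ring
      · have := dvd_sub (h i 0)
          ((delta_sq_dvd_w_pow_two_mul_sub_one β).mul_left (x * w ^ (α * i : ℕ)))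
        convert this using 1
        simp [Matrix.mul_apply]
        ring
  · refine ⟨w • N, ?_, w * x, ?_, ?_⟩
    · change _ • (V * (A.1 * gateOmega.1)) = _
      have : gateOmega.1 = omega • (1 : Matrix (Fin 2) (Fin 2) ℂ) := by
        ext i j
        fin_cases i <;> fin_cases j <;> simp [gateOmega, gateDiag]
      rw [this, Matrix.mul_smul, Matrix.mul_one, Matrix.mul_smul, smul_comm, hN]
      ext i j
      simp [coe_w]
    · rwa [isUnit_w.dvd_mul_left]
    · intro i j
      convert (h i j).mul_left w using 1
      simp
      ring

/-! ### Reading normal forms -/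

theorem tCount_append (M N : List Gate) : tCount (M ++ N) = tCount M + tCount N := by
  induction M with
  | nil => simp [tCount]
  | cons g M ih => cases g <;> simp only [List.cons_append, tCount, ih, Nat.add_right_comm]

theorem hCount_append (M N : List Gate) : hCount (M ++ N) = hCount M + hCount N := by
  induction M with
  | nil => simp [hCount]
  | cons g M ih => cases g <;> simp only [List.cons_append, hCount, ih, Nat.add_right_comm]

theorem circuitOp_append (M N : List Gate) : circuitOp (M ++ N) = circuitOp M * circuitOp N := by
  simp [circuitOp]

theorem circuitOp_cons (g : Gate) (M : List Gate) : circuitOp (g :: M) = g.op * circuitOp M := by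
  simp [circuitOp]

/-- A circuit with `n + 1` letters `H`, equal to a product of a core operator and `Tᵝ`. -/
def EndsInCore (M : List Gate) : Prop :=
  ∃ n β : ℕ, β ≤ 1 ∧ hCount M = n + 1 ∧ tCount M = n + β ∧
    ∃ V : U2, IsCore n V.1 ∧ circuitOp M = V * gateT ^ β

theorem EndsInCore.cons_S {M : List Gate} (hM : EndsInCore M) : EndsInCore (Gate.S :: M) := by
  obtain ⟨n, β, hβ, hh, ht, V, hV, h⟩ := hM
  refine ⟨n, β, hβ, by simpa [hCount], by simpa [tCount], gateS * V, hV.gateS_mul, ?_⟩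
  rw [circuitOp_cons, h, mul_assoc]
  rfl

theorem EndsInCore.cons_H_cons_T {M : List Gate} (hM : EndsInCore M) :
    EndsInCore (Gate.H :: Gate.T :: M) := by
  obtain ⟨n, β, hβ, hh, ht, V, hV, h⟩ := hM
  refine ⟨n + 1, β, hβ, by simpa [hCount], by simp [tCount, ht]; omega, gateH * gateT * V,
    hV.gateH_mul_gateT_mul, ?_⟩
  rw [circuitOp_cons, circuitOp_cons, h, mul_assoc, mul_assoc]
  rfl

theorem endsInCore_H : EndsInCore [Gate.H] :=
  ⟨0, 0, by simp, rfl, rfl, gateH, isCore_gateH, by simp [circuitOp, Gate.op]⟩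

theorem endsInCore_HT : EndsInCore [Gate.H, Gate.T] :=
  ⟨0, 1, le_rfl, rfl, rfl, gateH, isCore_gateH, by simp [circuitOp, Gate.op]⟩

theorem eq_nil_or_endsInCore (L : List (List Gate))
    (hL : ∀ s ∈ L, s = [Gate.H, Gate.T] ∨ s = [Gate.S, Gate.H, Gate.T]) {e : List Gate}
    (he : e = [] ∨ e = [Gate.H] ∨ e = [Gate.S, Gate.H]) :
    L.flatten ++ e = [] ∨ EndsInCore (L.flatten ++ e) := by
  induction L with
  | nil =>
    rcases he with rfl | rfl | rfl
    exacts [.inl rfl, .inr endsInCore_H, .inr endsInCore_H.cons_S]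
  | cons s L ih =>
    have hs := hL s (by simp)
    have hHT : EndsInCore (Gate.H :: Gate.T :: (L.flatten ++ e)) := by
      rcases ih fun s hs => hL s (by simp [hs]) with h | h
      · rw [h]
        exact endsInCore_HT
      · exact h.cons_H_cons_T
    right
    rcases hs with rfl | rfl
    exacts [hHT, hHT.cons_S]

/-- A normal form without `H` is `Tᵅ C`; any other normal form has the shape of a product
`Tᵅ V Tᵝ C` with `V` a core operator. -/
theorem hCount_eq_zero_or_hasShape {M : List Gate} (hM : M ∈ normalForms) :
    (hCount M = 0 ∧ tCount M ≤ 1 ∧ ∃ A ∈ groupS, circuitOp M = gateT ^ tCount M * A) ∨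
    ∃ n α β : ℕ, α ≤ 1 ∧ β ≤ 1 ∧ hCount M = n + 1 ∧ tCount M = n + α + β ∧
      HasShape n α β (circuitOp M).1 := by
  obtain ⟨_, ⟨_, ⟨p, hp, q, hq, rfl⟩, e, he, rfl⟩, _, ⟨A, rfl⟩, rfl⟩ := hM
  obtain ⟨L, rfl, hL⟩ := Language.mem_kstar.1 hq
  have hp' : ∃ α ≤ 1, hCount p = 0 ∧ tCount p = α ∧ circuitOp p = gateT ^ α := by
    rcases hp with rfl | rfl
    · exact ⟨1, le_rfl, rfl, rfl, by simp [circuitOp, Gate.op]⟩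
    · exact ⟨0, by simp, rfl, rfl, by simp [circuitOp]⟩
  obtain ⟨α, hα, hh, ht, hop⟩ := hp'
  have hC : circuitOp [Gate.C A] = A := by simp [circuitOp, Gate.op]
  rcases eq_nil_or_endsInCore L hL he with h | ⟨n, β, hβ, hh', ht', V, hV, h⟩
  · left
    dsimp only
    rw [List.append_assoc p, h, hCount_append, tCount_append, circuitOp_append, hC]
    simp [hCount, tCount, hh, ht, hop, hα]
  · refine .inr ⟨n, α, β, hα, hβ, ?_, ?_, ?_⟩
    · dsimp only
      rw [List.append_assoc p, hCount_append, hCount_append, hh, hh']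
      simp [hCount]
    · dsimp only
      rw [List.append_assoc p, tCount_append, tCount_append, ht, ht']
      simp only [tCount]
      omega
    · have := (hV.hasShape α β).mul_of_mem_groupS A.2
      dsimp only
      rw [List.append_assoc p, circuitOp_append, circuitOp_append, h, hop, hC, ← mul_assoc]
      exact this

/-! ### The least denominator exponent and its residue -/

/-- The matrix `√2ᵏ V` over `ℤ[ω]`, for a denominator exponent `k` of `V`. -/
noncomputable def scaled (k : ℕ) (V : Matrix (Fin 2) (Fin 2) ℂ) (hk : IsDenomExp k V) :
    Matrix (Fin 2) (Fin 2) Zomega :=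
  Matrix.of fun i j => ⟨sqrtTwo ^ k * V i j, hk i j⟩

theorem delta_pow_four_dvd_of_kResidue_eq {k k' : ℕ} {V V' : Matrix (Fin 2) (Fin 2) ℂ}
    {hk : IsDenomExp k V} {hk' : IsDenomExp k' V'} (h : kResidue k V hk = kResidue k' V' hk')
    (i j : Fin 2) : delta ^ 4 ∣ scaled k V hk i j - scaled k' V' hk' i j := by
  have := congrFun (congrFun h i) j
  simp only [kResidue, Matrix.of_apply, rho] at this
  rw [Ideal.Quotient.eq, Ideal.mem_span_singleton] at this
  exact delta_pow_four_dvd_two.trans this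

/-- The matrix `Z` is `δ^ε` times a matrix congruent to `x (1, ω^α)ᵀ (1, ω^β)` modulo `δ²`,
for some `x` prime to `δ`. -/
def IsReducedShape (ε α β : ℕ) (Z : Matrix (Fin 2) (Fin 2) Zomega) : Prop :=
  ∃ x, ¬ delta ∣ x ∧ ∃ Y : Matrix (Fin 2) (Fin 2) Zomega, Z = delta ^ ε • Y ∧
    ∀ i j : Fin 2, delta ^ 2 ∣ Y i j - x * w ^ (α * i + β * j : ℕ)

theorem not_delta_dvd_of_congr {x y : Zomega} {m : ℕ} (hx : ¬ delta ∣ x)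
    (h : delta ^ 2 ∣ y - x * w ^ m) : ¬ delta ∣ y := by
  intro hy
  apply hx
  have := dvd_sub hy ((dvd_pow_self delta two_ne_zero).trans h)
  rwa [sub_sub_cancel, (isUnit_w.pow m).dvd_mul_right] at this

/-- The exponent `n + 2` of `δ` in the denominator `√2 δⁿ` is `2k` or `2k - 1`, because
`√2` is a unit multiple of `δ²` and the numerators are prime to `δ`. -/
theorem HasShape.exists_isReducedShape {n α β k : ℕ} {V : Matrix (Fin 2) (Fin 2) ℂ}
    (hV : HasShape n α β V) (hk : IsLeastDenomExp k V) :
    ∃ ε ≤ 1, 2 * k = n + 2 + ε ∧ IsReducedShape ε α β (scaled k V hk.1) := by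
  obtain ⟨N, hN, x, hx, h⟩ := hV
  have hentry (i j : Fin 2) : sqrtTwo * (delta : ℂ) ^ n * V i j = N i j := by
    simpa using congrFun (congrFun hN i) j
  have hd : (delta : ℂ) ≠ 0 := by exact_mod_cast delta_ne_zero
  have hs := sqrtTwo_eq_delta_sq_mul
  push_cast at hs
  -- If `2k < n + 2`, then the numerator `N 0 0`, times a unit, is a multiple of `δ`.
  have hlow : n + 2 ≤ 2 * k := by
    by_contra! hlt
    obtain ⟨m, hm⟩ := Nat.exists_eq_add_of_lt hlt
    apply not_delta_dvd_of_congr hx (h 0 0)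
    rw [← (isUnit_unitV.pow k).dvd_mul_left]
    refine ⟨delta ^ m * unitV * scaled k V hk.1 0 0, ?_⟩
    apply mul_left_cancel₀ (pow_ne_zero (2 * k) delta_ne_zero)
    apply Subtype.ext
    simp only [scaled, Matrix.of_apply]
    push_cast
    rw [← hentry, hs]
    linear_combination (unitV : ℂ) ^ (k + 1) * (delta : ℂ) ^ (2 * k) * V 0 0 *
      congrArg ((delta : ℂ) ^ ·) hm
  have hscaled {m ε : ℕ} (hε : 2 * m = n + ε) (i j : Fin 2) :
      sqrtTwo ^ (m + 1) * V i j = (delta ^ ε * (unitV ^ m * N i j) : Zomega) := by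
    push_cast
    rw [← hentry, hs]
    linear_combination (unitV : ℂ) ^ (m + 1) * (delta : ℂ) ^ 2 * V i j *
      congrArg ((delta : ℂ) ^ ·) hε
  have hup : 2 * k ≤ n + 3 := by
    -- The exponent is `(n + 2) / 2`, rounded up.
    have : IsDenomExp ((n + 1) / 2 + 1) V := by
      intro i j
      rw [hscaled (ε := 2 * ((n + 1) / 2) - n) (by omega)]
      exact Subtype.prop _
    have := hk.2 this
    omega
  obtain ⟨ε, hε⟩ := Nat.exists_eq_add_of_le hlow
  obtain ⟨m, rfl⟩ : ∃ m, k = m + 1 := ⟨k - 1, by omega⟩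
  refine ⟨ε, by omega, hε, unitV ^ m * x, ?_, unitV ^ m • N, ?_, ?_⟩
  · rwa [(isUnit_unitV.pow m).dvd_mul_left]
  · ext i j
    exact hscaled (m := m) (ε := ε) (by omega) i j
  · intro i j
    convert (h i j).mul_left (unitV ^ m) using 1
    simp
    ring

/-! ### Recovering the parameters from the residue -/

theorem IsReducedShape.delta_dvd_iff {ε α β : ℕ} {Z : Matrix (Fin 2) (Fin 2) Zomega}
    (hZ : IsReducedShape ε α β Z) (hε : ε ≤ 1) : delta ∣ Z 0 0 ↔ ε = 1 := by
  obtain ⟨x, hx, Y, rfl, h⟩ := hZ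
  have := not_delta_dvd_of_congr hx (h 0 0)
  interval_cases ε <;> simp [this]

theorem delta_sq_dvd_sub_iff {x y z : Zomega} {m : ℕ} (hx : ¬ delta ∣ x) (hm : m ≤ 1)
    (hy : delta ^ 2 ∣ y - x) (hz : delta ^ 2 ∣ z - x * w ^ m) :
    delta ^ 2 ∣ z - y ↔ m = 0 := by
  rw [← eq_zero_iff_delta_sq_dvd hx hm,
    show z - y = x * (w ^ m - 1) + (z - x * w ^ m - (y - x)) by ring]
  exact dvd_add_left (dvd_sub hz hy)

theorem IsReducedShape.alpha_eq_zero_iff {ε α β : ℕ} {Z : Matrix (Fin 2) (Fin 2) Zomega}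
    (hZ : IsReducedShape ε α β Z) (hα : α ≤ 1) :
    delta ^ (ε + 2) ∣ Z 1 0 - Z 0 0 ↔ α = 0 := by
  obtain ⟨x, hx, Y, rfl, h⟩ := hZ
  rw [← delta_sq_dvd_sub_iff hx hα (by simpa using h 0 0) (by simpa using h 1 0), pow_add]
  simp only [Matrix.smul_apply, smul_eq_mul, ← mul_sub]
  exact mul_dvd_mul_iff_left (pow_ne_zero _ delta_ne_zero)

theorem IsReducedShape.beta_eq_zero_iff {ε α β : ℕ} {Z : Matrix (Fin 2) (Fin 2) Zomega}
    (hZ : IsReducedShape ε α β Z) (hβ : β ≤ 1) :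
    delta ^ (ε + 2) ∣ Z 0 1 - Z 0 0 ↔ β = 0 := by
  obtain ⟨x, hx, Y, rfl, h⟩ := hZ
  rw [← delta_sq_dvd_sub_iff hx hβ (by simpa using h 0 0) (by simpa using h 0 1), pow_add]
  simp only [Matrix.smul_apply, smul_eq_mul, ← mul_sub]
  exact mul_dvd_mul_iff_left (pow_ne_zero _ delta_ne_zero)

/-- Modulo `δ`, a reduced shape has rank at most one. -/
theorem IsReducedShape.delta_dvd_det {ε α β : ℕ} {Z : Matrix (Fin 2) (Fin 2) Zomega}
    (hZ : IsReducedShape ε α β Z) : delta ∣ Z.det := by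
  obtain ⟨x, hx, Y, rfl, h⟩ := hZ
  rw [Matrix.det_smul]
  apply Dvd.dvd.mul_left
  have h' (i j : Fin 2) : ∃ c, Y i j = x * w ^ (α * i + β * j : ℕ) + delta * c := by
    obtain ⟨c, hc⟩ := (dvd_pow_self delta two_ne_zero).trans (h i j)
    exact ⟨c, by rw [← hc]; ring⟩
  choose c hc using h'
  rw [Matrix.det_fin_two]
  simp only [hc, Fin.val_zero, Fin.val_one, mul_zero, mul_one, add_zero, zero_add]
  refine ⟨x * w ^ (α + β) * c 0 0 + x * c 1 1 + delta * c 0 0 * c 1 1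
    - x * w ^ β * c 1 0 - x * w ^ α * c 0 1 - delta * c 0 1 * c 1 0, ?_⟩
  ring

/-- Congruent matrices modulo `2` have the same parameters. -/
theorem IsReducedShape.congr {ε α β ε' α' β' : ℕ} {Z Z' : Matrix (Fin 2) (Fin 2) Zomega}
    (hZ : IsReducedShape ε α β Z) (hZ' : IsReducedShape ε' α' β' Z')
    (h : ∀ i j, delta ^ 4 ∣ Z i j - Z' i j) (hε : ε ≤ 1) (hε' : ε' ≤ 1) (hα : α ≤ 1)
    (hα' : α' ≤ 1) (hβ : β ≤ 1) (hβ' : β' ≤ 1) : ε = ε' ∧ α = α' ∧ β = β' := by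
  have h0 : ε = ε' := by
    have h1 : delta ∣ Z 0 0 ↔ delta ∣ Z' 0 0 :=
      dvd_iff_dvd_of_dvd_sub ((dvd_pow_self delta four_ne_zero).trans (h 0 0))
    rw [hZ.delta_dvd_iff hε, hZ'.delta_dvd_iff hε'] at h1
    omega
  subst h0
  have h2 (i j : Fin 2) :
      delta ^ (ε + 2) ∣ Z i j - Z 0 0 ↔ delta ^ (ε + 2) ∣ Z' i j - Z' 0 0 := by
    apply dvd_iff_dvd_of_dvd_sub
    have := (pow_dvd_pow delta (show ε + 2 ≤ 4 by omega)).trans (dvd_sub (h i j) (h 0 0))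
    convert this using 1
    ring
  have hA := h2 1 0
  have hB := h2 0 1
  rw [hZ.alpha_eq_zero_iff hα, hZ'.alpha_eq_zero_iff hα'] at hA
  rw [hZ.beta_eq_zero_iff hβ, hZ'.beta_eq_zero_iff hβ'] at hB
  omega

theorem delta_pow_four_dvd_det_sub_det {Z Z' : Matrix (Fin 2) (Fin 2) Zomega}
    (h : ∀ i j, delta ^ 4 ∣ Z i j - Z' i j) : delta ^ 4 ∣ Z.det - Z'.det := by
  have := dvd_sub (dvd_add ((h 0 0).mul_right (Z 1 1)) ((h 1 1).mul_left (Z' 0 0)))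
    (dvd_add ((h 0 1).mul_right (Z 1 0)) ((h 1 0).mul_left (Z' 0 1)))
  rw [Matrix.det_fin_two, Matrix.det_fin_two]
  convert this using 1
  ring

/-- An operator `Tᵅ C` is integral, and its determinant is `ω^α` times a power of `i`. -/
theorem det_scaled_gateT_pow_mul {α k : ℕ} {U A : U2} (hA : A ∈ groupS) (hU : U = gateT ^ α * A)
    (hk : IsLeastDenomExp k U.1) :
    k = 0 ∧ ∃ l : ℕ, (scaled k U.1 hk.1).det = w ^ (2 * l) * w ^ α := by
  have hmul : U.1 = (gateT ^ α).1 * A.1 := congrArg Subtype.val hU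
  have h0 : IsDenomExp 0 U.1 := by
    rw [hmul]
    refine IsDenomExp.mul (k := 0) (l := 0) ?_ (isDenomExp_groupS A hA)
    rw [gateT_pow]
    intro i j
    fin_cases i <;> fin_cases j <;>
      simp [Zomega.zero_mem, Zomega.one_mem, Zomega.pow_mem omega_mem]
  obtain rfl : k = 0 := Nat.le_zero.1 (hk.2 h0)
  obtain ⟨l, hl⟩ := exists_det_eq_of_mem_groupS hA
  refine ⟨rfl, l, ?_⟩
  have hdet : U.1.det = omega ^ (2 * l) * omega ^ α := by
    rw [hmul, Matrix.det_mul, hl, gateT_pow]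
    simp [mul_comm]
  apply Subtype.ext
  rw [Matrix.det_fin_two] at hdet ⊢
  simpa [scaled, coe_w] using hdet

theorem eq_of_delta_sq_dvd {α α' l l' : ℕ} (hα : α ≤ 1) (hα' : α' ≤ 1)
    (h : delta ^ 2 ∣ w ^ (2 * l) * w ^ α - w ^ (2 * l') * w ^ α') : α = α' := by
  have h1 := (delta_sq_dvd_w_pow_two_mul_sub_one l).mul_right (w ^ α)
  have h2 := (delta_sq_dvd_w_pow_two_mul_sub_one l').mul_right (w ^ α')
  have h3 : delta ^ 2 ∣ w ^ α - w ^ α' := by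
    convert dvd_add (dvd_sub h h1) h2 using 1
    ring
  have h4 := not_delta_sq_dvd_mul_w_sub_one (not_delta_dvd_of_isUnit isUnit_one)
  interval_cases α <;> interval_cases α'
  · rfl
  · rw [dvd_sub_comm] at h3
    simp at h3 h4
    exact absurd h3 h4
  · simp at h3 h4
    exact absurd h3 h4
  · rfl

end CliffordT

/-! ### Counts of normal forms -/

theorem mainTheorem8 :
    (∀ M ∈ CliffordT.normalForms, ∀ k : ℕ,
      CliffordT.IsLeastDenomExp k (CliffordT.circuitOp M : Matrix (Fin 2) (Fin 2) ℂ) →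
        (2 * (k : ℤ) - 3 ≤ CliffordT.tCount M ∧ (CliffordT.tCount M : ℤ) ≤ 2 * k + 1) ∧
        (2 * (k : ℤ) - 2 ≤ CliffordT.hCount M ∧ (CliffordT.hCount M : ℤ) ≤ 2 * k)) ∧
    (∀ M ∈ CliffordT.normalForms, ∀ M' ∈ CliffordT.normalForms, ∀ k k' : ℕ,
      ∀ (hk : CliffordT.IsLeastDenomExp k
          (CliffordT.circuitOp M : Matrix (Fin 2) (Fin 2) ℂ))
        (hk' : CliffordT.IsLeastDenomExp k'
          (CliffordT.circuitOp M' : Matrix (Fin 2) (Fin 2) ℂ)),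
        CliffordT.kResidue k (CliffordT.circuitOp M) hk.1 =
            CliffordT.kResidue k' (CliffordT.circuitOp M') hk'.1 →
          2 * (k : ℤ) - CliffordT.tCount M = 2 * (k' : ℤ) - CliffordT.tCount M' ∧
          2 * (k : ℤ) - CliffordT.hCount M = 2 * (k' : ℤ) - CliffordT.hCount M') := by
  open CliffordT in
  constructor
  · intro M hM k hk
    rcases hCount_eq_zero_or_hasShape hM with
      ⟨hh, ht, A, hA, hop⟩ | ⟨n, α, β, hα, hβ, hh, ht, hshape⟩
    · obtain ⟨rfl, -⟩ := det_scaled_gateT_pow_mul hA hop hk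
      omega
    · obtain ⟨ε, hε, hkε, -⟩ := hshape.exists_isReducedShape hk
      omega
  · intro M hM M' hM' k k' hk hk' hres
    have hcong := delta_pow_four_dvd_of_kResidue_eq hres
    have hdet := delta_pow_four_dvd_det_sub_det hcong
    -- A unit is not congruent modulo `2` to a multiple of `δ`.
    have hmixed {u v : Zomega} (h : delta ^ 4 ∣ u - v) (hu : IsUnit u) (hv : delta ∣ v) :
        False :=
      not_delta_dvd_of_isUnit hu
        ((dvd_iff_dvd_of_dvd_sub ((dvd_pow_self delta four_ne_zero).trans h)).2 hv)
    have hunit (l α : ℕ) : IsUnit (w ^ (2 * l) * w ^ α) := (isUnit_w.pow _).mul (isUnit_w.pow _)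
    rcases hCount_eq_zero_or_hasShape hM with
        ⟨hh, ht, A, hA, hop⟩ | ⟨n, α, β, hα, hβ, hh, ht, hshape⟩ <;>
      rcases hCount_eq_zero_or_hasShape hM' with
        ⟨hh', ht', A', hA', hop'⟩ | ⟨n', α', β', hα', hβ', hh', ht', hshape'⟩
    · obtain ⟨hk0, l, hl⟩ := det_scaled_gateT_pow_mul hA hop hk
      obtain ⟨hk0', l', hl'⟩ := det_scaled_gateT_pow_mul hA' hop' hk'
      rw [hl, hl'] at hdet
      have := eq_of_delta_sq_dvd ht ht' ((pow_dvd_pow delta (by norm_num)).trans hdet)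
      omega
    · obtain ⟨-, l, hl⟩ := det_scaled_gateT_pow_mul hA hop hk
      obtain ⟨ε', -, -, hZ'⟩ := hshape'.exists_isReducedShape hk'
      exact (hmixed hdet (hl ▸ hunit _ _) hZ'.delta_dvd_det).elim
    · obtain ⟨-, l', hl'⟩ := det_scaled_gateT_pow_mul hA' hop' hk'
      obtain ⟨ε, -, -, hZ⟩ := hshape.exists_isReducedShape hk
      exact (hmixed ((dvd_sub_comm).1 hdet) (hl' ▸ hunit _ _) hZ.delta_dvd_det).elim
    · obtain ⟨ε, hε, hkε, hZ⟩ := hshape.exists_isReducedShape hk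
      obtain ⟨ε', hε', hkε', hZ'⟩ := hshape'.exists_isReducedShape hk'
      obtain ⟨rfl, rfl, rfl⟩ := hZ.congr hZ' hcong hε hε' hα hα' hβ hβ'
      omega
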